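/- **Theorem (Erdős, Rogers).** There is an absolute constant $n_0$ such that for every $n\ge n_0$ and every convex body $K\subset\mathbb R^n$ (a compact convex set with non-empty interior) there are a full-rank lattice $\Lambda\subset\mathbb R^n$ and a finite set $T\subset\mathbb R^n$ for which the periodic arrangement of translates $K+v+t$ $(v\in\Lambda,\ t\in T)$ has all of the following properties: 1. it covers $\mathbb R^n$, that is, $\bigcup_{v\in\Lambda,\,t\in T}(K+v+t)=\mathbb R^n$; 2. every point of $\mathbb R^n$ lies in $K+v+t$ for at most $e\,(n\ln n+n\ln\ln n+4n)$ pairs $(v,t)\in\Lambda\times T$; 3. its density $|T|\operatorname{vol}(K)/\det\Lambda$ is less than $n\ln n+n\ln\ln n+4n$. -/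

import Mathlib

open MeasureTheory
open scoped Pointwise

/-- The periodic arrangement `K + Λ + T` of translates of `K`, as the family of the sets
`K + v + t` indexed by the pairs `(v, t)` with `v ∈ Λ` and `t ∈ T`. -/
def periodicArrangement {n : ℕ} (K : Set (EuclideanSpace ℝ (Fin n)))
    (Λ : Submodule ℤ (EuclideanSpace ℝ (Fin n))) (T : Finset (EuclideanSpace ℝ (Fin n))) :
    Λ × T → Set (EuclideanSpace ℝ (Fin n)) :=
  fun p => ((p.1 : EuclideanSpace ℝ (Fin n)) + (p.2 : EuclideanSpace ℝ (Fin n))) +ᵥ K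

/-- The density `|T| vol(K) / det Λ` of the periodic arrangement `K + Λ + T`. -/
noncomputable def arrangementDensity {n : ℕ} (K : Set (EuclideanSpace ℝ (Fin n)))
    (Λ : Submodule ℤ (EuclideanSpace ℝ (Fin n))) (T : Finset (EuclideanSpace ℝ (Fin n))) : ℝ :=
  (T.card : ℝ) * (volume K).toReal / ZLattice.covolume Λ volume

/-- The union of the family is the whole space. -/
def IsSpaceCovering {ι X : Type*} (F : ι → Set X) : Prop :=
  (⋃ i, F i) = Set.univ

/-- No point belongs to more than `m` members of the family (members are counted by index). -/
def MultiplicityAtMost {ι X : Type*} (F : ι → Set X) (m : ℝ) : Prop :=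
  ∀ x : X, {i | x ∈ F i}.Finite ∧ ({i | x ∈ F i}.ncard : ℝ) ≤ m

/-! The problem is made finite and then solved by random translates. After a translation, `0` is
interior to `K`. Put `η = 1/(2n ln n)` and let `F` be a very fine lattice. A homomorphism `φ : F →
ℤ/p` that is nonzero at every nonzero point of `F` in `D = (1+2η)K - (1+2η)K` embeds the points of
`(1+2η)K` in `ℤ/p`; its kernel is the lattice `Λ`, of index `p`
(`exists_surjective_linearMap_zmod`). Bertrand's postulate gives such a `p` of the order of the
number of points in `D`, so a weak Rogers–Shephard inequality yields `P = det Λ / vol K ≤ 6·4^n`.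

Choose `N` random residues as translates. The expected number of residues missed by `(1-2η)K`, plus
an exponential-moment bound for those covered too often by `(1+2η)K`, is less than the number of
lattice points in `ηK` (`exists_translates_few_bad`, `exists_number_of_translates`). Hence every
residue can be moved to a good one by a vector of `ηK` (`exists_residues_of_ncard`). Rounding to `F`
costs another `ηK`. The total error `2ηK` turns `(1-2η)K` into `K` for the covering, and `K` into
`(1+2η)K` for the multiplicity (`exists_arrangement_of_residues`). The density is at most `N/P`. -/

/-! ### Homomorphisms to `ℤ/p` avoiding zero on a finite set. -/

/-- Fewer than `p` vectors outside `p M` are all nonzero under some homomorphism to `ℤ/p`. -/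
theorem exists_linearMap_zmod_ne_zero {M : Type*} [AddCommGroup M] [Module.Free ℤ M]
    [Module.Finite ℤ M] (p : ℕ) [hp : Fact p.Prime] (S : Finset M) (hS : S.card < p)
    (hdiv : ∀ x ∈ S, ∀ y : M, x ≠ (p : ℤ) • y) :
    ∃ φ : M →ₗ[ℤ] ZMod p, ∀ x ∈ S, φ x ≠ 0 := by
  classical
  let ev : M → ((M →ₗ[ℤ] ZMod p) →+ ZMod p) := fun x =>
    { toFun := fun φ => φ x, map_zero' := by simp, map_add' := by simp }
  by_contra! hcon
  -- If no `φ` works, the kernels of the evaluations at points of `S` cover the dual. Neumann's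
  -- lemma gives one of index at most `|S| < p`, but evaluation at a vector outside `pM` has kernel
  -- of index exactly `p`.
  have hcover : ⋃ x ∈ S, ((0 : M →ₗ[ℤ] ZMod p) +ᵥ ((ev x).ker : Set (M →ₗ[ℤ] ZMod p))) =
      Set.univ := by
    refine Set.eq_univ_of_forall fun φ => ?_
    obtain ⟨x, hx, h0⟩ := hcon φ
    simp only [Set.mem_iUnion]
    exact ⟨x, hx, by simpa [ev] using h0⟩
  obtain ⟨x, hx, -, hle⟩ :=
    AddSubgroup.exists_index_le_card_of_leftCoset_cover (s := S) (g := fun _ => 0)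
      (H := fun x => (ev x).ker) hcover
  have hne : ev x ≠ 0 := by
    intro h
    let b := Module.Free.chooseBasis ℤ M
    have hcoord : ∀ i, (p : ℤ) ∣ b.repr x i := fun i => by
      have := DFunLike.congr_fun h
        ((Int.castAddHom (ZMod p)).toIntLinearMap ∘ₗ b.coord i)
      simpa [ev, ZMod.intCast_zmod_eq_zero_iff_dvd] using this
    choose c hc using hcoord
    refine hdiv x hx (∑ i, c i • b i) ?_
    conv_lhs => rw [← b.sum_repr x]
    simp [Finset.smul_sum, hc, mul_smul]
  have hindex : (ev x).ker.index = p := by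
    have hr : (ev x).range = ⊤ := by
      have : Fact (Nat.card (ZMod p)).Prime := ⟨by simpa using hp.out⟩
      obtain h | h := (ev x).range.eq_bot_or_eq_top_of_prime_card
      · exact absurd ((AddMonoidHom.range_eq_bot_iff).1 h) hne
      · exact h
    rw [AddSubgroup.index_ker, hr]
    simp
  omega

/-- Any nonzero map to `ℤ/p` is onto; adding a basis vector to the avoided set forces this, at the
cost of one more element. -/
theorem exists_surjective_linearMap_zmod {M : Type*} [AddCommGroup M] [Module.Free ℤ M]
    [Module.Finite ℤ M] [Nontrivial M] (p : ℕ) [hp : Fact p.Prime] (S : Finset M)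
    (hS : S.card + 1 < p) (hdiv : ∀ x ∈ S, ∀ y : M, x ≠ (p : ℤ) • y) :
    ∃ φ : M →ₗ[ℤ] ZMod p, Function.Surjective φ ∧ ∀ x ∈ S, φ x ≠ 0 := by
  classical
  let b := Module.Free.chooseBasis ℤ M
  obtain ⟨i⟩ : Nonempty (Module.Free.ChooseBasisIndex ℤ M) := b.index_nonempty
  obtain ⟨φ, hφ⟩ := exists_linearMap_zmod_ne_zero p (insert (b i) S)
    ((Finset.card_insert_le _ _).trans_lt hS) (by
      intro x hx y hxy
      obtain rfl | hx := Finset.mem_insert.1 hx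
      · have h := congrArg (fun z => b.repr z i) hxy
        simp only [Module.Basis.repr_self, Finsupp.single_eq_same, map_smul, Finsupp.smul_apply,
          smul_eq_mul] at h
        have h1 : (p : ℤ) ∣ 1 := ⟨_, h⟩
        have h2 := Int.natAbs_dvd_natAbs.2 h1
        exact hp.out.one_lt.ne' (Nat.dvd_one.1 (by simpa using h2))
      · exact hdiv x hx y hxy)
  refine ⟨φ, fun g => ?_, fun x hx => hφ x (Finset.mem_insert_of_mem hx)⟩
  refine ⟨(g * (φ (b i))⁻¹).val • b i, ?_⟩
  rw [map_nsmul, nsmul_eq_mul, ZMod.natCast_zmod_val,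
    inv_mul_cancel_right₀ (hφ _ (Finset.mem_insert_self _ _))]

/-! ### Random translates in a finite group. -/

/-- By averaging over all `N`-tuples, some `N` translates leave few points of a finite group
uncovered by `A` and few points covered `M` times by `B`. -/
theorem exists_translates_few_bad {G : Type*} [AddCommGroup G] [Fintype G] [DecidableEq G]
    (A B : Finset G) (N : ℕ) (M w : ℝ)
    (hw : (Fintype.card G : ℝ) * (Real.exp (-(N * A.card / Fintype.card G)) +
      Real.exp ((Real.exp 1 - 1) * (N * B.card / Fintype.card G) - M)) < w) :
    ∃ X : Finset G, X.card ≤ N ∧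
      ((Finset.univ.filter fun g => ∀ x ∈ X, g - x ∉ A).card : ℝ) < w ∧
      ((Finset.univ.filter fun g => M ≤ ((X.filter fun x => g - x ∈ B).card : ℝ)).card : ℝ) <
        w := by
  set q : ℝ := (Fintype.card G : ℝ) with hq
  have hq0 : 0 < q := by rw [hq]; exact_mod_cast Fintype.card_pos
  have avg (H : G → ℝ) : ∑ x : Fin N → G, ∑ g, ∏ i, H (g - x i) = q * (∑ h, H h) ^ N := by
    rw [Finset.sum_comm]
    have : ∀ g, ∑ x : Fin N → G, ∏ i, H (g - x i) = (∑ h, H h) ^ N := fun g => by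
      rw [← Equiv.sum_comp (Equiv.subLeft g) H, Fintype.sum_pow]
      rfl
    simp [this, hq]
  have pow_le (t : ℝ) (ht : 0 ≤ 1 + t / q) : (q + t) ^ N ≤ q ^ N * Real.exp (N * (t / q)) := by
    have : q + t = q * (1 + t / q) := by field_simp
    rw [this, mul_pow, Real.exp_nat_mul]
    gcongr
    linarith [Real.add_one_le_exp (t / q)]
  -- The product of `H₁` over the tuple is the indicator that `g` is uncovered; that of `H₂`, times
  -- `exp (-M)`, dominates the indicator of multiplicity at least `M`. Averages of both factor over
  -- the coordinates, and bounding their sum lets one tuple serve both purposes.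
  let H₁ : G → ℝ := fun h => if h ∈ A then 0 else 1
  let H₂ : G → ℝ := fun h => if h ∈ B then Real.exp 1 else 1
  have s₁ : ∑ h, H₁ h = q + (-A.card) := by
    have : ∀ h, H₁ h = 1 - if h ∈ A then 1 else 0 := fun h => by
      by_cases hh : h ∈ A <;> simp [H₁, hh]
    simp only [this, Finset.sum_sub_distrib]
    simp [hq, sub_eq_add_neg]
  have s₂ : ∑ h, H₂ h = q + (Real.exp 1 - 1) * B.card := by
    have : ∀ h, H₂ h = 1 + (Real.exp 1 - 1) * if h ∈ B then 1 else 0 := fun h => by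
      by_cases hh : h ∈ B <;> simp [H₂, hh]
    simp only [this, Finset.sum_add_distrib, ← Finset.mul_sum]
    simp [hq]
  have hAq : (A.card : ℝ) ≤ q := by rw [hq]; exact_mod_cast A.card_le_univ
  have hsum : ∑ x : Fin N → G, ((∑ g, ∏ i, H₁ (g - x i)) +
      Real.exp (-M) * ∑ g, ∏ i, H₂ (g - x i)) <
      ∑ x : Fin N → G, w := by
    rw [Finset.sum_add_distrib, ← Finset.mul_sum, avg, avg, s₁, s₂]
    have e1 : 0 ≤ Real.exp 1 - 1 := by linarith [Real.add_one_le_exp (1 : ℝ)]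
    have h₁ := pow_le (-A.card) (by rw [neg_div]; linarith [(div_le_one hq0).2 hAq])
    have h₂ := pow_le ((Real.exp 1 - 1) * B.card) (by positivity)
    have : ∑ x : Fin N → G, w = q ^ N * w := by simp [hq]
    rw [this]
    calc _ ≤ q * (q ^ N * Real.exp (N * (-A.card / q))) + Real.exp (-M) *
          (q * (q ^ N * Real.exp (N * ((Real.exp 1 - 1) * B.card / q)))) := by gcongr
      _ = q ^ N * (q * (Real.exp (-(N * A.card / q)) +
          Real.exp ((Real.exp 1 - 1) * (N * B.card / q) - M))) := by
        rw [sub_eq_add_neg _ M, Real.exp_add]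
        have i₁ : (N : ℝ) * (-A.card / q) = -(N * A.card / q) := by ring
        have i₂ : (N : ℝ) * ((Real.exp 1 - 1) * B.card / q) =
          (Real.exp 1 - 1) * (N * B.card / q) := by ring
        rw [i₁, i₂]
        ring
      _ < q ^ N * w := by gcongr
  obtain ⟨x, -, hx⟩ := Finset.exists_lt_of_sum_lt hsum
  have n₁ : ∀ g, 0 ≤ ∏ i, H₁ (g - x i) := fun g => Finset.prod_nonneg fun i _ => by
    simp only [H₁]; split_ifs <;> norm_num
  have n₂ : ∀ g, 0 ≤ ∏ i, H₂ (g - x i) := fun g => Finset.prod_nonneg fun i _ => by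
    simp only [H₂]; split_ifs <;> positivity
  -- Merging repeated entries leaves the uncovered set unchanged and can only lower multiplicities.
  refine ⟨Finset.univ.image x, Finset.card_image_le.trans (by simp), ?_, ?_⟩
  · refine lt_of_le_of_lt ?_ hx
    refine le_add_of_le_of_nonneg ?_ (mul_nonneg (Real.exp_pos _).le
      (Finset.sum_nonneg fun g _ => n₂ g))
    rw [Finset.card_eq_sum_ones, Nat.cast_sum, Finset.sum_filter]
    refine Finset.sum_le_sum fun g _ => ?_
    split_ifs with h
    · rw [Finset.prod_eq_one]
      · simp
      · intro i _
        simp [H₁, h (x i) (by simp)]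
    · exact n₁ g
  · refine lt_of_le_of_lt ?_ hx
    refine le_add_of_nonneg_of_le (Finset.sum_nonneg fun g _ => n₁ g) ?_
    rw [Finset.card_eq_sum_ones, Nat.cast_sum, Finset.sum_filter, Finset.mul_sum]
    refine Finset.sum_le_sum fun g _ => ?_
    split_ifs with h
    · have : ∏ i, H₂ (g - x i) =
          Real.exp ((Finset.univ.filter fun i => g - x i ∈ B).card) := by
        simp only [H₂]
        rw [Finset.prod_ite]
        simp [← Real.exp_nat_mul]
      rw [this, ← Real.exp_add, Nat.cast_one, Real.one_le_exp_iff]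
      have hle : ((Finset.univ.image x).filter fun y => g - y ∈ B).card ≤
          (Finset.univ.filter fun i => g - x i ∈ B).card := by
        rw [Finset.filter_image]
        exact Finset.card_image_le
      have : (((Finset.univ.image x).filter fun y => g - y ∈ B).card : ℝ) ≤
          (Finset.univ.filter fun i => g - x i ∈ B).card := by exact_mod_cast hle
      linarith
    · exact mul_nonneg (Real.exp_pos _).le (n₂ g)

/-! ### The sublattice of index `p`. -/

section kernelLattice

variable {E : Type*} [NormedAddCommGroup E]
  (F : Submodule ℤ E) {p : ℕ} (φ : F →ₗ[ℤ] ZMod p)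

/-- The kernel of a homomorphism on a lattice, as a sublattice of the ambient space. -/
def kernelLattice : Submodule ℤ E := (LinearMap.ker φ).map F.subtype

theorem mem_kernelLattice {x : E} : x ∈ kernelLattice F φ ↔ ∃ y : F, φ y = 0 ∧ (y : E) = x := by
  simp [kernelLattice]

theorem kernelLattice_le : kernelLattice F φ ≤ F := Submodule.map_subtype_le _ _

theorem kernelLattice_discreteTopology [DiscreteTopology F] :
    DiscreteTopology (kernelLattice F φ) :=
  DiscreteTopology.of_subset (s := (F : Set E)) inferInstance (kernelLattice_le F φ)

theorem kernelLattice_isZLattice [NormedSpace ℝ E] [DiscreteTopology F] [IsZLattice ℝ F]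
    [Fact p.Prime]
    [DiscreteTopology (kernelLattice F φ)] : IsZLattice ℝ (kernelLattice F φ) where
  span_top := by
    rw [eq_top_iff, ← IsZLattice.span_top (K := ℝ) (L := F), Submodule.span_le]
    intro x hx
    have hp : (p : ℝ) ≠ 0 := by exact_mod_cast (Fact.out : p.Prime).ne_zero
    have : x = (p : ℝ)⁻¹ • ((p : ℝ) • x) := by rw [smul_smul, inv_mul_cancel₀ hp, one_smul]
    rw [this]
    refine Submodule.smul_mem _ _ (Submodule.subset_span ?_)
    refine (mem_kernelLattice F φ).2 ⟨p • ⟨x, hx⟩, ?_, ?_⟩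
    · rw [map_nsmul]; simp
    · simp [Nat.cast_smul_eq_nsmul]

theorem covolume_kernelLattice [InnerProductSpace ℝ E] [FiniteDimensional ℝ E] [MeasurableSpace E]
    [BorelSpace E] [DiscreteTopology F] [IsZLattice ℝ F] [DiscreteTopology (kernelLattice F φ)]
    [IsZLattice ℝ (kernelLattice F φ)] (hφ : Function.Surjective φ) :
    ZLattice.covolume (kernelLattice F φ) = p * ZLattice.covolume F := by
  have h := ZLattice.covolume_div_covolume_eq_relIndex' (kernelLattice F φ) F
    (kernelLattice_le F φ)
  rw [div_eq_iff (ZLattice.covolume_ne_zero F volume)] at h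
  rw [h]
  congr 2
  have : (kernelLattice F φ).toAddSubgroup.addSubgroupOf F.toAddSubgroup =
      φ.toAddMonoidHom.ker := by
    ext x
    rw [AddSubgroup.mem_addSubgroupOf]
    change (x : E) ∈ kernelLattice F φ ↔ φ x = 0
    rw [mem_kernelLattice]
    constructor
    · rintro ⟨y, hy, hyx⟩
      rwa [← Subtype.ext hyx]
    · exact fun h => ⟨x, h, rfl⟩
  rw [AddSubgroup.relIndex, this, AddSubgroup.index_ker]
  have hr : φ.toAddMonoidHom.range = ⊤ := AddMonoidHom.range_eq_top.2 hφ
  rw [hr]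
  simp

end kernelLattice

/-! ### From residues to an arrangement in space. -/

theorem Convex.add_smul_mem_smul {E : Type*} [AddCommGroup E] [Module ℝ E] {K : Set E}
    (hK : Convex ℝ K) {a b c : ℝ} (ha : 0 ≤ a) (hb : 0 ≤ b) (hc : a + b = c) {x y : E}
    (hx : x ∈ a • K) (hy : y ∈ b • K) : x + y ∈ c • K := by
  rw [← hc, hK.add_smul ha hb]
  exact Set.add_mem_add hx hy

/-- A good set of residues modulo the kernel of `φ` on a fine lattice gives a covering of the whole
space by translates of `K` with the same multiplicity bound. -/
theorem exists_arrangement_of_residues {n : ℕ} {K : Set (EuclideanSpace ℝ (Fin n))}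
    (hK : Convex ℝ K) (F : Submodule ℤ (EuclideanSpace ℝ (Fin n)))
    {p : ℕ} (φ : F →ₗ[ℤ] ZMod p) (hφ : Function.Surjective φ) {η : ℝ} (hη : 0 < η)
    (hη2 : 2 * η ≤ 1)
    (hround : ∀ z : EuclideanSpace ℝ (Fin n), ∃ f : F, z - f ∈ η • K ∧ (f : _) - z ∈ η • K)
    (hinj : ∀ x : F, (x : EuclideanSpace ℝ (Fin n)) ∈ (1 + 2 * η) • K - (1 + 2 * η) • K →
      φ x = 0 → x = 0)
    (X : Finset (ZMod p)) (M : ℝ)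
    (hcov : ∀ g : ZMod p, ∃ w : F, (w : EuclideanSpace ℝ (Fin n)) ∈ η • K ∧
      ∃ x ∈ X, ∃ y : F, (y : EuclideanSpace ℝ (Fin n)) ∈ (1 - 2 * η) • K ∧ φ y = g - φ w - x)
    (hmult : ∀ g : ZMod p, ∃ w : F, (w : EuclideanSpace ℝ (Fin n)) ∈ η • K ∧
      ({x ∈ (X : Set (ZMod p)) | ∃ y : F, (y : EuclideanSpace ℝ (Fin n)) ∈ (1 + 2 * η) • K ∧
        φ y = g + φ w - x}.ncard : ℝ) ≤ M) :
    ∃ T : Finset (EuclideanSpace ℝ (Fin n)), T.card ≤ X.card ∧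
      IsSpaceCovering (periodicArrangement K (kernelLattice F φ) T) ∧
      MultiplicityAtMost (periodicArrangement K (kernelLattice F φ) T) M := by
  classical
  choose σ hσ using hφ
  have hmem : ∀ (z : EuclideanSpace ℝ (Fin n)) (v t : EuclideanSpace ℝ (Fin n)),
      z ∈ (v + t) +ᵥ K ↔ z - v - t ∈ K := fun z v t => by
    rw [Set.mem_vadd_set_iff_neg_vadd_mem, vadd_eq_add]
    congr! 1; abel
  refine ⟨X.image fun x => (σ x : EuclideanSpace ℝ (Fin n)), Finset.card_image_le, ?_, ?_⟩
  · refine Set.eq_univ_of_forall fun z => Set.mem_iUnion.2 ?_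
    obtain ⟨f, hf, -⟩ := hround z
    obtain ⟨w, hw, x, hx, y, hy, hyx⟩ := hcov (φ f)
    refine ⟨(⟨(f - w - y - σ x : F), (mem_kernelLattice F φ).2 ⟨_, ?_, rfl⟩⟩,
      ⟨σ x, Finset.mem_image_of_mem _ hx⟩), ?_⟩
    · simp [hσ, hyx]
    · rw [periodicArrangement, hmem]
      have h₁ := hK.add_smul_mem_smul hη.le hη.le rfl hf hw
      have h₂ := hK.add_smul_mem_smul (add_nonneg hη.le hη.le) (by linarith) (c := 1) (by ring)
        h₁ hy
      rw [one_smul] at h₂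
      convert h₂ using 1
      push_cast
      abel
  · intro z
    -- `K` need not be symmetric, so signs matter: here `f - z` and `+w` lie in `ηK`, whereas the
    -- covering uses `z - f` and `f - w`.
    obtain ⟨f, -, hf⟩ := hround z
    obtain ⟨w, hw, hle⟩ := hmult (φ f)
    set X' := {x ∈ (X : Set (ZMod p)) | ∃ y : F, (y : EuclideanSpace ℝ (Fin n)) ∈
      (1 + 2 * η) • K ∧ φ y = φ f + φ w - x} with hX'
    have hX'fin : X'.Finite := X.finite_toSet.subset fun x hx => hx.1
    set P := {i | z ∈ periodicArrangement K (kernelLattice F φ)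
      (X.image fun x => (σ x : EuclideanSpace ℝ (Fin n))) i} with hP
    have hτ : ∀ i : (kernelLattice F φ) × (X.image fun x => (σ x : EuclideanSpace ℝ (Fin n))),
        ∃ x ∈ X, (σ x : EuclideanSpace ℝ (Fin n)) = i.2 := fun i => by
      simpa using Finset.mem_image.1 i.2.2
    choose τ hτX hτ using hτ
    have key : ∀ i ∈ P, ∃ u : F, φ u = 0 ∧ (u : EuclideanSpace ℝ (Fin n)) = i.1 ∧
        ((f + w - u - σ (τ i) : F) : EuclideanSpace ℝ (Fin n)) ∈ (1 + 2 * η) • K := by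
      intro i hi
      obtain ⟨u, hu, hui⟩ := (mem_kernelLattice F φ).1 i.1.2
      refine ⟨u, hu, hui, ?_⟩
      have hi' := (hmem _ _ _).1 hi
      rw [← one_smul ℝ K] at hi'
      have h₁ := hK.add_smul_mem_smul hη.le hη.le rfl hf hw
      have h₂ := hK.add_smul_mem_smul (add_nonneg hη.le hη.le) zero_le_one
        (c := 1 + 2 * η) (by ring) h₁ hi'
      convert h₂ using 1
      push_cast
      rw [hτ, hui]
      abel
    have hmaps : ∀ i ∈ P, τ i ∈ X' := by
      intro i hi
      obtain ⟨u, hu, -, h⟩ := key i hi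
      exact ⟨hτX i, _, h, by simp [hu, hσ]⟩
    have hinjOn : Set.InjOn τ P := by
      intro i hi j hj hij
      obtain ⟨u, hu, hui, h₁⟩ := key i hi
      obtain ⟨v, hv, hvj, h₂⟩ := key j hj
      -- Two members with the same residue differ by a kernel vector in the difference body, hence
      -- coincide.
      have h₀ := hinj (u - v) (by
        convert Set.sub_mem_sub h₂ h₁ using 1
        push_cast
        rw [hij]
        abel) (by simp [hu, hv])
      have huv : u = v := sub_eq_zero.1 h₀
      refine Prod.ext (Subtype.ext ?_) (Subtype.ext ?_)
      · rw [← hui, ← hvj, huv]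
      · rw [← hτ, ← hτ, hij]
    refine ⟨hX'fin.of_injOn hmaps hinjOn, le_trans ?_ hle⟩
    exact_mod_cast Set.ncard_le_ncard_of_injOn τ hmaps hinjOn hX'fin

/-! ### Volume of the difference body. -/

theorem Convex.half_smul_add_subset_inter {E : Type*} [AddCommGroup E] [Module ℝ E] {B : Set E}
    (hB : Convex ℝ B) {u w : E} (hu : u ∈ B) (hw : w ∈ B) :
    (2⁻¹ : ℝ) • u +ᵥ (2⁻¹ : ℝ) • B ⊆
      B ∩ (fun y => y - (2⁻¹ : ℝ) • (u - w)) ⁻¹' B := by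
  rintro _ ⟨_, ⟨b, hb, rfl⟩, rfl⟩
  refine ⟨hB hu hb (by norm_num) (by norm_num) (by norm_num), ?_⟩
  have := hB hw hb (a := 2⁻¹) (b := 2⁻¹) (by norm_num) (by norm_num) (by norm_num)
  simp only [Set.mem_preimage, vadd_eq_add]
  convert this using 1
  module

/-- A weak form of the Rogers–Shephard inequality for the difference body. -/
theorem Convex.volume_sub_self_le {E : Type*} [NormedAddCommGroup E] [NormedSpace ℝ E]
    [FiniteDimensional ℝ E] [MeasurableSpace E] [BorelSpace E] (μ : Measure E)
    [μ.IsAddHaarMeasure] {B : Set E} (hB : Convex ℝ B) (hc : IsCompact B) (h0 : μ B ≠ 0) :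
    μ.real (B - B) ≤ 4 ^ Module.finrank ℝ E * μ.real B := by
  set d := Module.finrank ℝ E with hd
  have hBm : MeasurableSet B := hc.measurableSet
  have htop : μ B ≠ ⊤ := hc.measure_lt_top.ne
  set c : ENNReal := ENNReal.ofReal ((2⁻¹ : ℝ) ^ d) with hcdef
  have hscale : ∀ S : Set E, μ ((2⁻¹ : ℝ) • S) = c * μ S := fun S => by
    rw [Measure.addHaar_smul, abs_of_nonneg (by positivity)]
  -- The measure of this set is computed in two ways: integrating over `y` gives `μ(B)²`, while each
  -- fibre over `x = (u - w)/2` contains a translate of `B/2`.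
  have hS : MeasurableSet {q : E × E | q.2 ∈ B ∧ q.2 - q.1 ∈ B} :=
    (measurable_snd hBm).inter ((measurable_snd.sub measurable_fst) hBm)
  have h₁ : (μ.prod μ) {q : E × E | q.2 ∈ B ∧ q.2 - q.1 ∈ B} = μ B * μ B := by
    rw [Measure.prod_apply_symm hS]
    have : ∀ y, μ ((fun x => (x, y)) ⁻¹' {q : E × E | q.2 ∈ B ∧ q.2 - q.1 ∈ B}) =
        B.indicator (fun _ => μ B) y := fun y => by
      by_cases hy : y ∈ B
      · rw [Set.indicator_of_mem hy]
        have : (fun x => (x, y)) ⁻¹' {q : E × E | q.2 ∈ B ∧ q.2 - q.1 ∈ B} =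
            (fun x => y - x) ⁻¹' B := by
          ext x; simp [hy]
        rw [this, (Measure.measurePreserving_sub_left μ y).measure_preimage hBm.nullMeasurableSet]
      · rw [Set.indicator_of_notMem hy]
        simp [hy]
    simp_rw [this]
    rw [lintegral_indicator hBm]
    simp
  have h₂ : c * μ (B - B) * (c * μ B) ≤
      (μ.prod μ) {q : E × E | q.2 ∈ B ∧ q.2 - q.1 ∈ B} := by
    rw [Measure.prod_apply hS, ← hscale (B - B)]
    calc μ ((2⁻¹ : ℝ) • (B - B)) * (c * μ B)
        = ∫⁻ _ in (2⁻¹ : ℝ) • (B - B), c * μ B ∂μ := by simp [mul_comm]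
      _ ≤ ∫⁻ x in (2⁻¹ : ℝ) • (B - B),
            μ (Prod.mk x ⁻¹' {q : E × E | q.2 ∈ B ∧ q.2 - q.1 ∈ B}) ∂μ := by
          refine setLIntegral_mono' ((sub_eq_add_neg B B ▸ hc.add hc.neg).smul (2⁻¹ : ℝ)).measurableSet ?_
          rintro _ ⟨_, ⟨u, hu, w, hw, rfl⟩, rfl⟩
          rw [← hscale, ← measure_vadd μ ((2⁻¹ : ℝ) • u) ((2⁻¹ : ℝ) • B)]
          exact measure_mono (hB.half_smul_add_subset_inter hu hw)
      _ ≤ _ := setLIntegral_le_lintegral _ _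
  rw [h₁] at h₂
  have h₃ := ENNReal.toReal_mono (by finiteness) h₂
  simp only [ENNReal.toReal_mul, hcdef, ENNReal.toReal_ofReal
    (show (0 : ℝ) ≤ (2⁻¹ : ℝ) ^ d by positivity), ← measureReal_def] at h₃
  have hpos : 0 < μ.real B := ENNReal.toReal_pos h0 htop
  have h4 : (4 : ℝ) ^ d * ((2⁻¹ : ℝ) ^ d * (2⁻¹ : ℝ) ^ d) = 1 := by
    rw [← mul_pow, ← mul_pow]; norm_num
  have h₅ : (2⁻¹ : ℝ) ^ d * (2⁻¹ : ℝ) ^ d * μ.real (B - B) ≤ μ.real B := by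
    refine le_of_mul_le_mul_right ?_ hpos
    linarith
  calc μ.real (B - B) = 4 ^ d * ((2⁻¹ : ℝ) ^ d * (2⁻¹ : ℝ) ^ d * μ.real (B - B)) := by
        rw [← mul_assoc, h4, one_mul]
    _ ≤ _ := by gcongr

/-! ### Choice of the number of translates. -/

theorem eventually_log_bounds : ∀ᶠ n : ℕ in Filter.atTop,
    100 ≤ Real.log n ∧ 0 ≤ Real.log (Real.log n) ∧
      100 * Real.log (Real.log n) ≤ Real.log n ∧ (1000 : ℝ) ≤ n := by
  have hl : Filter.Tendsto (fun n : ℕ => Real.log n) Filter.atTop Filter.atTop :=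
    Real.tendsto_log_atTop.comp tendsto_natCast_atTop_atTop
  have h₁ := (Real.isLittleO_log_id_atTop.bound (c := 1 / 100) (by norm_num))
  filter_upwards [hl.eventually_ge_atTop 100, hl.eventually h₁,
    tendsto_natCast_atTop_atTop.eventually_ge_atTop (1000 : ℝ)] with n h2 h3 h4
  have h5 : 0 ≤ Real.log (Real.log n) := Real.log_nonneg (by linarith)
  simp only [id, Real.norm_eq_abs, abs_of_nonneg h5, abs_of_nonneg (by linarith : 0 ≤ Real.log n)]
    at h3
  exact ⟨h2, h5, by linarith, h4⟩

theorem one_div_two_mul_log_pow {n : ℕ} (hn : (0 : ℝ) < n) (hl : 0 < Real.log n) :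
    (1 / (2 * n * Real.log n)) ^ n =
      Real.exp (-(n * Real.log n + n * Real.log (Real.log n) + n * Real.log 2)) := by
  have : 1 / (2 * n * Real.log n) =
      Real.exp (-(Real.log 2 + Real.log n + Real.log (Real.log n))) := by
    rw [Real.exp_neg, Real.exp_add, Real.exp_add, Real.exp_log hn, Real.exp_log (by norm_num),
      Real.exp_log hl, one_div]
  rw [this, ← Real.exp_nat_mul]
  ring_nf

theorem four_pow_eq_exp (n : ℕ) : (4 : ℝ) ^ n = Real.exp (n * (2 * Real.log 2)) := by
  rw [Real.exp_nat_mul, two_mul, Real.exp_add, Real.exp_log (by norm_num)]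
  norm_num

-- With `S = n ln n + n ln ln n`, the density `N/P` is taken close to `S + 3.5n`, leaving room below
-- `S + 4n`. The relative errors in `a` and `b`, of order `1/ln n`, cost only `O(n)`, so both
-- exponents are at most `-(S + 2.34n)`. Against `P ≤ 6·4^n` and `w ≥ exp(-(S + n ln 2))/2` this
-- suffices because `2.34 > 3 ln 2`.
set_option maxHeartbeats 1000000 in
theorem exists_number_of_translates {n : ℕ} (hl : 100 ≤ Real.log n)
    (hL : 0 ≤ Real.log (Real.log n)) (hLl : 100 * Real.log (Real.log n) ≤ Real.log n)
    (hn : (1000 : ℝ) ≤ n) {P a b w : ℝ} (hP1 : 1 ≤ P) (hP : P ≤ 6 * 4 ^ n)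
    (ha : 1 - 1.1 / Real.log n ≤ a) (hb : b ≤ 1 + 1.2 / Real.log n)
    (hw : (1 / (2 * n * Real.log n)) ^ n / 2 ≤ w) :
    ∃ N : ℕ, N / P < n * Real.log n + n * Real.log (Real.log n) + 4 * n ∧
      P * (Real.exp (-(N / P * a)) + Real.exp ((Real.exp 1 - 1) * (N / P * b) -
        Real.exp 1 * (n * Real.log n + n * Real.log (Real.log n) + 4 * n))) < w := by
  set x : ℝ := (n : ℝ) with hx
  set l := Real.log x with hldef
  set L := Real.log l with hLdef
  set S := x * l + x * L with hS
  have hl0 : 0 < l := by linarith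
  have hx0 : 0 < x := by linarith
  have hP0 : 0 < P := by linarith
  have hSnn : 0 ≤ S := by positivity
  have hSl : S / l = x + x * (L / l) := by rw [hS]; field_simp
  have hq : L / l ≤ 1 / 100 := by rw [div_le_div_iff₀ hl0 (by norm_num)]; linarith
  have hq0 : 0 ≤ L / l := by positivity
  have hi : 1 / l ≤ 1 / 100 := one_div_le_one_div_of_le (by norm_num) hl
  have hi0 : 0 < 1 / l := by positivity
  have hxq : x * (L / l) ≤ x / 100 := by
    linarith [mul_le_mul_of_nonneg_left hq hx0.le]
  have hxi : x * (1 / l) ≤ x / 100 := by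
    linarith [mul_le_mul_of_nonneg_left hi hx0.le]
  set N := ⌈(S + 3.5 * x) * P⌉₊ with hN
  set t := (N : ℝ) / P with ht
  have ht1 : S + 3.5 * x ≤ t := by
    rw [ht, le_div_iff₀ hP0]; exact Nat.le_ceil _
  have ht2 : t ≤ S + 3.5 * x + 1 := by
    rw [ht, div_le_iff₀ hP0]
    have : (N : ℝ) ≤ (S + 3.5 * x) * P + 1 :=
      (Nat.ceil_lt_add_one (show 0 ≤ (S + 3.5 * x) * P by positivity)).le
    rw [add_mul _ 1, one_mul]
    linarith
  have ht0 : 0 ≤ t := by linarith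
  have hta : S + 2.34 * x ≤ t * a := by
    have h1 : (S + 3.5 * x) * (1 - 1.1 / l) = S + 3.5 * x - 1.1 * (S / l) -
      3.85 * (x * (1 / l)) := by ring
    have h2 : (0 : ℝ) ≤ 1 - 1.1 / l := by
      have : 1.1 / l = 1.1 * (1 / l) := by ring
      linarith
    have h3 : (S + 3.5 * x) * (1 - 1.1 / l) ≤ t * a := mul_le_mul ht1 ha h2 ht0
    rw [h1, hSl] at h3
    linarith
  have htb : t * b ≤ S + 4.756 * x + 1.1 := by
    have h1 : (S + 3.5 * x + 1) * (1 + 1.2 / l) = S + 3.5 * x + 1 + 1.2 * (S / l) +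
      4.2 * (x * (1 / l)) + 1.2 * (1 / l) := by ring
    have h3 : t * b ≤ (S + 3.5 * x + 1) * (1 + 1.2 / l) :=
      (mul_le_mul_of_nonneg_left hb ht0).trans
        (mul_le_mul_of_nonneg_right ht2 (by positivity))
    rw [h1, hSl] at h3
    linarith
  have he1 := Real.exp_one_gt_d9
  have he2 := Real.exp_one_lt_d9
  have hexp2 : (Real.exp 1 - 1) * (t * b) - Real.exp 1 * (S + 4 * x) ≤ -(S + 2.34 * x) := by
    have h1 : (Real.exp 1 - 1) * (t * b) ≤ (Real.exp 1 - 1) * (S + 4.756 * x + 1.1) :=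
      mul_le_mul_of_nonneg_left htb (by linarith)
    have h2 : (Real.exp 1 - 1) * (S + 4.756 * x + 1.1) - Real.exp 1 * (S + 4 * x) =
      -S + Real.exp 1 * (0.756 * x + 1.1) - 4.756 * x - 1.1 := by ring
    have h3 : Real.exp 1 * (0.756 * x + 1.1) ≤ 2.72 * (0.756 * x + 1.1) := by
      gcongr
      linarith
    linarith
  have hlog2 := Real.log_two_lt_d9
  have hη : (1 / (2 * x * l)) ^ n = Real.exp (-(S + x * Real.log 2)) := by
    rw [one_div_two_mul_log_pow hx0 hl0]
  have h4 := four_pow_eq_exp n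
  refine ⟨N, by linarith, lt_of_lt_of_le ?_ hw⟩
  calc P * (Real.exp (-(t * a)) + Real.exp ((Real.exp 1 - 1) * (t * b) -
        Real.exp 1 * (S + 4 * x)))
      ≤ 6 * 4 ^ n * (Real.exp (-(S + 2.34 * x)) + Real.exp (-(S + 2.34 * x))) := by
        gcongr
    _ = 12 * Real.exp (x * (2 * Real.log 2) - (S + 2.34 * x)) := by
        rw [h4, Real.exp_sub, Real.exp_neg]; ring
    _ < Real.exp (-(S + x * Real.log 2)) / 2 := by
        have h24 : 24 < Real.exp (0.26 * x) := by
          have := Real.add_one_le_exp (0.26 * x)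
          linarith
        have : Real.exp (-(S + x * Real.log 2)) =
            Real.exp (x * (2 * Real.log 2) - (S + 2.34 * x)) *
              Real.exp (2.34 * x - 3 * (x * Real.log 2)) := by
          rw [← Real.exp_add]; ring_nf
        rw [this]
        have h5 : Real.exp (0.26 * x) ≤ Real.exp (2.34 * x - 3 * (x * Real.log 2)) := by
          apply Real.exp_le_exp.2
          linarith [mul_le_mul_of_nonneg_left hlog2.le hx0.le]
        have h6 := Real.exp_pos (x * (2 * Real.log 2) - (S + 2.34 * x))
        nlinarith
    _ = _ := by rw [hη]

/-! ### Fine lattices and their point counts. -/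

section refinedLattice

variable {E : Type*} [NormedAddCommGroup E] [NormedSpace ℝ E] [FiniteDimensional ℝ E]

/-- Multiplication by `m + 1`. -/
noncomputable def scaleEquiv (E : Type*) [NormedAddCommGroup E] [NormedSpace ℝ E] (m : ℕ) :
    E ≃L[ℝ] E :=
  ContinuousLinearEquiv.smulLeft (Units.mk0 ((m + 1 : ℕ) : ℝ) (by positivity))

/-- The lattice `L / (m + 1)`. -/
noncomputable abbrev refinedLattice (L : Submodule ℤ E) (m : ℕ) : Submodule ℤ E :=
  ZLattice.comap ℝ L (scaleEquiv E m).toLinearMap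

omit [FiniteDimensional ℝ E] in
theorem mem_refinedLattice {L : Submodule ℤ E} {m : ℕ} {x : E} :
    x ∈ refinedLattice L m ↔ ((m + 1 : ℕ) : ℝ) • x ∈ L := Iff.rfl

theorem covolume_refinedLattice [MeasurableSpace E] [BorelSpace E] (μ : Measure E)
    [μ.IsAddHaarMeasure] (L : Submodule ℤ E) [DiscreteTopology L] [IsZLattice ℝ L] (m : ℕ) :
    ZLattice.covolume (refinedLattice L m) μ =
      ZLattice.covolume L μ / ((m + 1 : ℕ) : ℝ) ^ Module.finrank ℝ E := by
  rw [ZLattice.covolume_eq_measure_fundamentalDomain _ _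
      (ZLattice.isAddFundamentalDomain (Module.Free.chooseBasis ℤ L) μ),
    ZLattice.covolume_eq_measure_fundamentalDomain _ _ (ZLattice.isAddFundamentalDomain
      ((Module.Free.chooseBasis ℤ L).ofZLatticeComap ℝ L (scaleEquiv E m).toLinearEquiv) μ)]
  have h : ZSpan.fundamentalDomain (((Module.Free.chooseBasis ℤ L).ofZLatticeComap ℝ L
      (scaleEquiv E m).toLinearEquiv).ofZLatticeBasis ℝ (refinedLattice L m)) =
      (((m + 1 : ℕ) : ℝ) • ·) ⁻¹'
        ZSpan.fundamentalDomain ((Module.Free.chooseBasis ℤ L).ofZLatticeBasis ℝ L) := by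
    change _ = (scaleEquiv E m) ⁻¹' _
    rw [← (scaleEquiv E m).image_symm_eq_preimage, ← (scaleEquiv E m).symm.coe_toLinearEquiv,
      ZSpan.map_fundamentalDomain]
    congr!
    ext; simp
  rw [h, measureReal_def, Measure.addHaar_preimage_smul _ (by positivity), ENNReal.toReal_mul,
    ENNReal.toReal_ofReal (abs_nonneg _), abs_of_nonneg (by positivity), measureReal_def,
    inv_mul_eq_div]

theorem exists_mem_refinedLattice_norm_sub_lt (L : Submodule ℤ E) [DiscreteTopology L]
    [IsZLattice ℝ L] {r : ℝ} (hr : 0 < r) :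
    ∀ᶠ m in Filter.atTop, ∀ z : E, ∃ f ∈ refinedLattice L m, ‖z - f‖ < r := by
  let b := (Module.Free.chooseBasis ℤ L).ofZLatticeBasis ℝ L
  set C := ∑ i, ‖b i‖ with hC
  have hC0 : 0 ≤ C := by positivity
  obtain ⟨m₀, hm₀⟩ := exists_nat_gt (C / r)
  filter_upwards [Filter.eventually_ge_atTop m₀] with m hm z
  have hm1 : (0 : ℝ) < ((m + 1 : ℕ) : ℝ) := by positivity
  refine ⟨(((m + 1 : ℕ) : ℝ))⁻¹ • (ZSpan.floor b (((m + 1 : ℕ) : ℝ) • z) : E), ?_, ?_⟩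
  · rw [mem_refinedLattice, smul_inv_smul₀ hm1.ne']
    have := (ZSpan.floor b (((m + 1 : ℕ) : ℝ) • z)).2
    exact (Module.Free.chooseBasis ℤ L).ofZLatticeBasis_span ℝ |>.le this
  · have : z - (((m + 1 : ℕ) : ℝ))⁻¹ • (ZSpan.floor b (((m + 1 : ℕ) : ℝ) • z) : E) =
        (((m + 1 : ℕ) : ℝ))⁻¹ • ZSpan.fract b (((m + 1 : ℕ) : ℝ) • z) := by
      rw [ZSpan.fract_apply, smul_sub, inv_smul_smul₀ hm1.ne']
    rw [this, norm_smul, Real.norm_of_nonneg (by positivity), inv_mul_lt_iff₀ hm1]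
    calc _ ≤ C := ZSpan.norm_fract_le b _
      _ < m₀ * r := (div_lt_iff₀ hr).1 hm₀
      _ ≤ _ := by gcongr; omega

end refinedLattice

theorem tendsto_card_refinedLattice {E : Type*} [NormedAddCommGroup E] [InnerProductSpace ℝ E]
    [FiniteDimensional ℝ E] [MeasurableSpace E] [BorelSpace E] (L : Submodule ℤ E)
    [DiscreteTopology L] [IsZLattice ℝ L] {s : Set E} (hs : Bornology.IsBounded s)
    (hm : MeasurableSet s) (hf : volume (frontier s) = 0) :
    Filter.Tendsto (fun m : ℕ => ({x : refinedLattice L m | (x : E) ∈ s}.ncard : ℝ) *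
      ZLattice.covolume (refinedLattice L m)) Filter.atTop (nhds (volume.real s)) := by
  have h := (ZLattice.covolume.tendsto_card_div_pow' L hs hm hf)
    |>.comp (Filter.tendsto_add_atTop_nat 1)
  have h' := h.mul_const (ZLattice.covolume L)
  rw [div_mul_cancel₀ _ (ZLattice.covolume_ne_zero L volume)] at h'
  refine h'.congr fun m => ?_
  have hm1 : (((m + 1 : ℕ) : ℝ)) ≠ 0 := by positivity
  rw [covolume_refinedLattice]
  have hc : Nat.card (s ∩ ((m + 1 : ℕ) : ℝ)⁻¹ • (L : Set E) : Set E) =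
      {x : refinedLattice L m | (x : E) ∈ s}.ncard := by
    rw [Nat.card_coe_set_eq, ← Set.ncard_image_of_injective _ Subtype.val_injective]
    congr 1
    ext x
    rw [Set.mem_inter_iff, Set.mem_inv_smul_set_iff₀ hm1]
    simp [mem_refinedLattice, and_comm]
  simp only [Function.comp_apply]
  rw [hc]
  ring

theorem finite_setOf_coe_mem {E : Type*} [NormedAddCommGroup E] [ProperSpace E]
    (F : Submodule ℤ E) [DiscreteTopology F] {s : Set E} (hs : Bornology.IsBounded s) :
    {x : F | (x : E) ∈ s}.Finite := by
  have hcl : IsClosed (F : Set E) := by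
    have : DiscreteTopology F.toAddSubgroup := inferInstanceAs (DiscreteTopology F)
    exact AddSubgroup.isClosed_of_discrete (H := F.toAddSubgroup)
  have h := Metric.finite_isBounded_inter_isClosed (s := (F : Set E))
    (DiscreteTopology.isDiscrete (s := (F : Set E))) hs hcl
  exact (h.preimage Subtype.val_injective.injOn).subset fun x hx => ⟨hx, x.2⟩

/-- If `x = py`, convexity puts the `p` distinct points `0, y, …, (p-1)y` in `D`, too many. -/
theorem ne_prime_smul_of_ncard_lt {E : Type*} [NormedAddCommGroup E] [NormedSpace ℝ E]
    (F : Submodule ℤ E) {D : Set E} (hD : Convex ℝ D) (h0 : (0 : E) ∈ D)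
    (hfin : {x : F | (x : E) ∈ D}.Finite) {p : ℕ} (hp : {x : F | (x : E) ∈ D}.ncard < p)
    {x : F} (hx : (x : E) ∈ D) (hx0 : x ≠ 0) (y : F) : x ≠ (p : ℤ) • y := by
  rintro rfl
  have hp0 : (0 : ℝ) < p := by exact_mod_cast (Nat.zero_le _).trans_lt hp
  have hy : (y : E) ≠ 0 := by
    intro h
    exact hx0 (by rw [Subtype.ext h (a2 := (0 : F)), smul_zero])
  have hinj : Function.Injective fun k : Fin p => ((k : ℕ) • y : F) := by
    intro k l hkl
    have h : ((k : ℕ) : ℝ) • (y : E) = ((l : ℕ) : ℝ) • (y : E) := by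
      simpa [Nat.cast_smul_eq_nsmul] using congrArg (Subtype.val) hkl
    exact Fin.ext (by exact_mod_cast smul_left_injective ℝ hy h)
  have hmem : Set.range (fun k : Fin p => ((k : ℕ) • y : F)) ⊆ {x : F | (x : E) ∈ D} := by
    rintro _ ⟨k, rfl⟩
    have hk : ((k : ℕ) : ℝ) ≤ p := by exact_mod_cast k.2.le
    have := hD.smul_mem_of_zero_mem h0 hx (t := (k : ℕ) / (p : ℝ))
      ⟨by positivity, (div_le_one hp0).2 hk⟩
    have he : ((k : ℕ) / (p : ℝ)) • (((p : ℤ) • y : F) : E) = (((k : ℕ) • y : F) : E) := by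
      change ((k : ℕ) / (p : ℝ)) • ((p : ℤ) • (y : E)) = (k : ℕ) • (y : E)
      rw [← Int.cast_smul_eq_zsmul ℝ, smul_smul, ← Nat.cast_smul_eq_nsmul ℝ]
      congr 1
      push_cast
      field_simp
    rw [he] at this
    exact this
  have h := Set.ncard_le_ncard hmem hfin
  rw [← Set.image_univ, Set.ncard_image_of_injective _ hinj, Set.ncard_univ, Nat.card_fin] at h
  omega

/-- Each bad set is smaller than `W`, on which `φ` is injective, so neither `g - φ(W)` nor `g +
φ(W)` can consist of bad residues. -/
theorem exists_residues_of_ncard {M : Type*} [AddCommGroup M] {p : ℕ} [Fact p.Prime]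
    (φ : M →ₗ[ℤ] ZMod p) {A B W : Set M} (hA : A.Finite) (hB : B.Finite)
    (hAi : Set.InjOn φ A) (hBi : Set.InjOn φ B) (hWi : Set.InjOn φ W) (N : ℕ) (m : ℝ)
    (hN : (p : ℝ) * (Real.exp (-(N * A.ncard / p)) +
      Real.exp ((Real.exp 1 - 1) * (N * B.ncard / p) - m)) < W.ncard) :
    ∃ X : Finset (ZMod p), X.card ≤ N ∧
      (∀ g : ZMod p, ∃ w ∈ W, ∃ x ∈ X, ∃ y ∈ A, φ y = g - φ w - x) ∧
      ∀ g : ZMod p, ∃ w ∈ W,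
        ({x ∈ (X : Set (ZMod p)) | ∃ y ∈ B, φ y = g + φ w - x}.ncard : ℝ) ≤ m := by
  classical
  have hcard : ∀ {s : Set M} (hs : s.Finite), Set.InjOn φ s →
      (hs.toFinset.image φ).card = s.ncard := fun hs hi => by
    rw [Finset.card_image_of_injOn (by simpa using hi), Set.ncard_eq_toFinset_card _ hs]
  obtain ⟨X, hXN, h₁, h₂⟩ := exists_translates_few_bad (hA.toFinset.image φ)
    (hB.toFinset.image φ) N m W.ncard (by rwa [hcard hA hAi, hcard hB hBi, ZMod.card])
  have large : ∀ (f : ZMod p → ZMod p), Function.Injective f → ∀ R : Finset (ZMod p),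
      (R.card : ℝ) < W.ncard → ∃ w ∈ W, f (φ w) ∉ R := by
    intro f hf R hR
    by_contra! h
    have hle := Set.ncard_le_ncard_of_injOn (t := (R : Set (ZMod p))) (fun w => f (φ w))
      (fun w hw => h w hw) (fun w hw w' hw' hww => hWi hw hw' (hf hww)) R.finite_toSet
    rw [Set.ncard_coe_finset] at hle
    exact absurd hR (not_lt.2 (by exact_mod_cast hle))
  refine ⟨X, hXN, fun g => ?_, fun g => ?_⟩
  · obtain ⟨w, hw, hwn⟩ := large (fun r => g - r) sub_right_injective _ h₁
    simp only [Finset.mem_filter, Finset.mem_univ, true_and, not_forall, not_not] at hwn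
    obtain ⟨x, hx, hxA⟩ := hwn
    obtain ⟨y, hy, hyx⟩ := Finset.mem_image.1 hxA
    exact ⟨w, hw, x, hx, y, by simpa using hy, hyx⟩
  · obtain ⟨w, hw, hwn⟩ := large (fun r => g + r) (add_right_injective g) _ h₂
    simp only [Finset.mem_filter, Finset.mem_univ, true_and, not_le] at hwn
    refine ⟨w, hw, le_trans ?_ hwn.le⟩
    rw [← Set.ncard_coe_finset]
    refine Nat.cast_le.2 (Set.ncard_le_ncard ?_ (Finset.finite_toSet _))
    rintro x ⟨hx, y, hy, hyx⟩
    simp only [Finset.coe_filter, Set.mem_ofPred_eq]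
    exact ⟨hx, Finset.mem_image.2 ⟨y, by simpa using hy, hyx⟩⟩

/-! ### Assembly for a body with `0` in its interior. -/

theorem one_sub_lt_one_sub_pow {n : ℕ} {l : ℝ} (hn : (1000 : ℝ) ≤ n) (hl : 100 ≤ l) :
    1 - 1.1 / l < (1 - 2 * (1 / (2 * n * l))) ^ n := by
  have hn0 : (0 : ℝ) < n := by linarith
  have hl0 : 0 < l := by linarith
  have h1 : 2 * (1 / (2 * n * l)) = 1 / (n * l) := by field_simp
  have h2 : 1 / (n * l) ≤ 1 := by
    rw [div_le_one (by positivity)]; nlinarith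
  have h := one_add_mul_le_pow (a := -(1 / (n * l))) (by linarith) n
  rw [h1, sub_eq_add_neg 1 (1 / (n * l))]
  refine lt_of_lt_of_le ?_ h
  have h3 : (n : ℝ) * -(1 / (n * l)) = -(1 / l) := by field_simp
  rw [h3]
  have h4 : 1.1 / l = 1 / l + 0.1 * (1 / l) := by ring
  have : 0 < 1 / l := by positivity
  linarith

theorem one_add_pow_lt_one_add {n : ℕ} {l : ℝ} (hn : (1000 : ℝ) ≤ n) (hl : 100 ≤ l) :
    (1 + 2 * (1 / (2 * n * l))) ^ n < 1 + 1.2 / l := by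
  have hn0 : (0 : ℝ) < n := by linarith
  have hl0 : 0 < l := by linarith
  have hi : 1 / l ≤ 1 / 100 := one_div_le_one_div_of_le (by norm_num) hl
  have hi0 : 0 < 1 / l := by positivity
  have h1 : (1 + 2 * (1 / (2 * n * l))) ^ n ≤ Real.exp (1 / l) := by
    have : 1 / l = n * (2 * (1 / (2 * n * l))) := by field_simp
    rw [this, Real.exp_nat_mul]
    gcongr
    linarith [Real.add_one_le_exp (2 * (1 / (2 * n * l)))]
  refine h1.trans_lt ?_
  have h2 := (abs_le.1 (Real.abs_exp_sub_one_sub_id_le (x := 1 / l)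
    (by rw [abs_of_pos hi0]; linarith))).2
  have h3 : 1.2 / l = 1 / l + 0.2 * (1 / l) := by ring
  nlinarith

theorem exists_arrangement_of_zero_mem_interior {n : ℕ} (hl : 100 ≤ Real.log n)
    (hL : 0 ≤ Real.log (Real.log n)) (hLl : 100 * Real.log (Real.log n) ≤ Real.log n)
    (hn : (1000 : ℝ) ≤ n) {K : Set (EuclideanSpace ℝ (Fin n))} (hK : Convex ℝ K)
    (hc : IsCompact K) (h0 : 0 ∈ interior K) :
    ∃ (Λ : Submodule ℤ (EuclideanSpace ℝ (Fin n)))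
      (_ : DiscreteTopology Λ) (_ : IsZLattice ℝ Λ)
      (T : Finset (EuclideanSpace ℝ (Fin n))),
      IsSpaceCovering (periodicArrangement K Λ T) ∧
      MultiplicityAtMost (periodicArrangement K Λ T)
        (Real.exp 1 * ((n : ℝ) * Real.log n + n * Real.log (Real.log n) + 4 * n)) ∧
      arrangementDensity K Λ T <
        (n : ℝ) * Real.log n + n * Real.log (Real.log n) + 4 * n := by
  classical
  have hn0 : (0 : ℝ) < n := by linarith
  have hnn : n ≠ 0 := by rintro rfl; simp at hn0
  have : Nontrivial (EuclideanSpace ℝ (Fin n)) := by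
    have : NeZero n := ⟨hnn⟩
    infer_instance
  have hfr : Module.finrank ℝ (EuclideanSpace ℝ (Fin n)) = n := finrank_euclideanSpace_fin
  set l := Real.log n with hldef
  -- Small enough that `(1 ± 2η)^n` is `1 + O(1/ln n)`, yet large enough that `η^n = exp(-(S + n ln
  -- 2))`, with `S = n ln n + n ln ln n` as the main term.
  set η : ℝ := 1 / (2 * n * l) with hηdef
  have hl0 : 0 < l := by linarith
  have hη : 0 < η := by positivity
  have hη2 : 2 * η ≤ 1 := by
    have : 2 * η = 1 / (n * l) := by rw [hηdef]; field_simp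
    rw [this, div_le_one (by positivity)]; nlinarith
  have h0K : (0 : EuclideanSpace ℝ (Fin n)) ∈ K := interior_subset h0
  have hmono : ∀ {a b : ℝ}, 0 ≤ a → a ≤ b → a • K ⊆ b • K := fun {a b} ha hab x hx => by
    have := hK.add_smul_mem_smul ha (sub_nonneg.2 hab) (c := b) (by ring) hx
      ⟨0, h0K, smul_zero _⟩
    rwa [add_zero] at this
  set V := volume.real K with hV
  have hvol0 : volume K ≠ 0 :=
    (Measure.measure_pos_of_nonempty_interior volume ⟨0, h0⟩).ne'
  have hV0 : 0 < V := ENNReal.toReal_pos hvol0 hc.measure_lt_top.ne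
  have hvol : ∀ {r : ℝ}, 0 ≤ r → volume.real (r • K) = r ^ n * V := fun {r} hr => by
    rw [measureReal_def, Measure.addHaar_smul, ENNReal.toReal_mul,
      ENNReal.toReal_ofReal (abs_nonneg _), hfr, abs_of_nonneg (by positivity)]
    rfl
  set A₀ := (1 - 2 * η) • K
  set B₀ := (1 + 2 * η) • K with hB₀
  set W₀ := η • K
  set D₀ := B₀ - B₀ with hD₀
  have hBc : IsCompact B₀ := hc.smul _
  have hDc : IsCompact D₀ := by
    rw [hD₀, sub_eq_add_neg]
    exact hBc.add hBc.neg
  have hDconv : Convex ℝ D₀ := (hK.smul _).sub (hK.smul _)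
  have hB0 : (0 : EuclideanSpace ℝ (Fin n)) ∈ B₀ := ⟨0, h0K, smul_zero _⟩
  have hBD : B₀ ⊆ D₀ := fun x hx => ⟨x, hx, 0, hB0, sub_zero x⟩
  have hD0 : (0 : EuclideanSpace ℝ (Fin n)) ∈ D₀ := hBD hB0
  have hAB : A₀ ⊆ B₀ := hmono (by linarith) (by linarith)
  have hWB : W₀ ⊆ B₀ := hmono (by linarith) (by linarith)
  have hpowA := one_sub_lt_one_sub_pow hn hl
  have hpowB := one_add_pow_lt_one_add hn hl
  have hBvol : volume B₀ ≠ 0 := by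
    intro h
    have h' := hvol (r := 1 + 2 * η) (by positivity)
    rw [measureReal_def, h, ENNReal.toReal_zero] at h'
    have : 0 < (1 + 2 * η) ^ n * V := by positivity
    linarith
  have hDvol : volume.real D₀ < 3 * 4 ^ n * V := by
    have h := (hK.smul (1 + 2 * η)).volume_sub_self_le volume hBc hBvol
    rw [hfr, hvol (by positivity)] at h
    refine h.trans_lt ?_
    have : (1 + 2 * η) ^ n < 3 := by
      refine hpowB.trans_le ?_
      have : 1.2 / l ≤ 1 := by rw [div_le_one hl0]; linarith
      linarith
    calc (4 : ℝ) ^ n * ((1 + 2 * η) ^ n * V) < 4 ^ n * (3 * V) := by gcongr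
      _ = _ := by ring
  obtain ⟨r, hr, hrW⟩ : ∃ r > 0, Metric.ball (0 : EuclideanSpace ℝ (Fin n)) r ⊆ W₀ := by
    have : W₀ ∈ nhds (0 : EuclideanSpace ℝ (Fin n)) := by
      have h := (set_smul_mem_nhds_zero_iff hη.ne').2 (mem_interior_iff_mem_nhds.1 h0)
      exact h
    exact Metric.mem_nhds_iff.1 this
  let L : Submodule ℤ (EuclideanSpace ℝ (Fin n)) :=
    Submodule.span ℤ (Set.range (EuclideanSpace.basisFun (Fin n) ℝ).toBasis)
  have count : ∀ {s : Set (EuclideanSpace ℝ (Fin n))}, Convex ℝ s → IsCompact s → Filter.Tendsto (fun m : ℕ =>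
      ({x : refinedLattice L m | (x : EuclideanSpace ℝ (Fin n)) ∈ s}.ncard : ℝ) *
        ZLattice.covolume (refinedLattice L m)) Filter.atTop (nhds (volume.real s)) :=
    fun hs hsc => tendsto_card_refinedLattice L hsc.isBounded hsc.measurableSet
      (hs.addHaar_frontier volume)
  have evA := (count (hK.smul (1 - 2 * η)) (hc.smul _)).eventually_const_lt
    (u := (1 - 1.1 / l) * V) (by rw [hvol (by linarith)]; gcongr)
  have evB := (count (hK.smul (1 + 2 * η)) (hc.smul _)).eventually_lt_const
    (u := (1 + 1.2 / l) * V) (by rw [hvol (by linarith)]; gcongr)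
  -- This second bound on the same count gives `P ≥ 1`, so that rounding `N` up adds at most `1` to
  -- the density.
  have evB' := (count (hK.smul (1 + 2 * η)) (hc.smul _)).eventually_const_lt (u := V) (by
    rw [hvol (by linarith)]
    have : 1 < (1 + 2 * η) ^ n := one_lt_pow₀ (by linarith) hnn
    exact lt_mul_left hV0 this)
  have evW := (count (hK.smul η) (hc.smul _)).eventually_const_lt
    (u := η ^ n / 2 * V) (by
      rw [hvol hη.le]
      have : 0 < η ^ n := by positivity
      gcongr
      linarith)
  have evD := (count hDconv hDc).eventually_lt_const hDvol
  obtain ⟨m, hA, hB, hB', hW, hD, hround⟩ := (evA.and (evB.and (evB'.and (evW.and (evD.and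
    (exists_mem_refinedLattice_norm_sub_lt L hr)))))).exists
  set F := refinedLattice L m with hF
  set c := ZLattice.covolume F with hcdef
  have hc0 : 0 < c := ZLattice.covolume_pos F volume
  have fin : ∀ {s : Set (EuclideanSpace ℝ (Fin n))}, s ⊆ D₀ → {x : F | (x : EuclideanSpace ℝ (Fin n)) ∈ s}.Finite := fun hs =>
    finite_setOf_coe_mem F (hDc.isBounded.subset hs)
  have hDpos : {x : F | (x : EuclideanSpace ℝ (Fin n)) ∈ D₀}.ncard ≠ 0 :=
    ((Set.ncard_pos (fin subset_rfl)).2 ⟨0, hD0⟩).ne'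
  -- Bertrand's postulate. The lower bound allows a separating `φ`, since removing `0` from `D₀`
  -- pays for the extra basis vector; the upper bound controls `P`.
  obtain ⟨p, hp, hDp, hpD⟩ := Nat.exists_prime_lt_and_le_two_mul _ hDpos
  have : Fact p.Prime := ⟨hp⟩
  have hp0 : (0 : ℝ) < p := by exact_mod_cast hp.pos
  have : Nontrivial F := by
    by_contra h
    rw [not_nontrivial_iff_subsingleton] at h
    have hbot : F = ⊥ := Submodule.subsingleton_iff_eq_bot.1 h
    have htop := IsZLattice.span_top (K := ℝ) (L := F)
    rw [hbot] at htop
    simp at htop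
  obtain ⟨φ, hφ, hφS⟩ := exists_surjective_linearMap_zmod p ((fin subset_rfl).toFinset.erase 0)
    (by
      rw [Finset.card_erase_of_mem (by simpa using hD0), ← Set.ncard_eq_toFinset_card _ (fin subset_rfl)]
      omega)
    (fun x hx => by
      simp only [Finset.mem_erase, Set.Finite.mem_toFinset] at hx
      exact ne_prime_smul_of_ncard_lt F hDconv hD0 (fin subset_rfl) hDp hx.2 hx.1)
  have hinj : ∀ x : F, (x : EuclideanSpace ℝ (Fin n)) ∈ D₀ → φ x = 0 → x = 0 := fun x hx h => by
    by_contra hx0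
    exact hφS x (by simpa using ⟨hx0, hx⟩) h
  have hBi : Set.InjOn φ {x : F | (x : EuclideanSpace ℝ (Fin n)) ∈ B₀} := fun x hx y hy hxy =>
    sub_eq_zero.1 (hinj (x - y) (Set.sub_mem_sub hx hy) (by rw [map_sub, hxy, sub_self]))
  have hBleD : ({x : F | (x : EuclideanSpace ℝ (Fin n)) ∈ B₀}.ncard : ℝ) ≤ {x : F | (x : EuclideanSpace ℝ (Fin n)) ∈ D₀}.ncard := by
    exact Nat.cast_le.2 (Set.ncard_le_ncard (Set.preimage_mono hBD) (fin subset_rfl))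
  have hDp' : ({x : F | (x : EuclideanSpace ℝ (Fin n)) ∈ D₀}.ncard : ℝ) ≤ p := by exact_mod_cast hDp.le
  have hpD' : (p : ℝ) ≤ 2 * {x : F | (x : EuclideanSpace ℝ (Fin n)) ∈ D₀}.ncard := by exact_mod_cast hpD
  obtain ⟨N, hN, hNw⟩ := exists_number_of_translates hl hL hLl hn
    (P := p * c / V) (a := {x : F | (x : EuclideanSpace ℝ (Fin n)) ∈ A₀}.ncard * c / V)
    (b := {x : F | (x : EuclideanSpace ℝ (Fin n)) ∈ B₀}.ncard * c / V) (w := {x : F | (x : EuclideanSpace ℝ (Fin n)) ∈ W₀}.ncard * c / V)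
    (by
      rw [le_div_iff₀ hV0, one_mul]
      exact hB'.le.trans (mul_le_mul_of_nonneg_right (hBleD.trans hDp') hc0.le))
    (by
      rw [div_le_iff₀ hV0]
      calc (p : ℝ) * c ≤ 2 * {x : F | (x : EuclideanSpace ℝ (Fin n)) ∈ D₀}.ncard * c := by gcongr
        _ = 2 * ({x : F | (x : EuclideanSpace ℝ (Fin n)) ∈ D₀}.ncard * c) := by ring
        _ ≤ 2 * (3 * 4 ^ n * V) := by gcongr
        _ = _ := by ring)
    (by rw [le_div_iff₀ hV0]; exact hA.le)
    (by rw [div_le_iff₀ hV0]; exact hB.le)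
    (by rw [le_div_iff₀ hV0]; exact hW.le)
  set m₁ := Real.exp 1 * ((n : ℝ) * l + n * Real.log l + 4 * n)
  have cancel : ∀ u : ℝ, N / (p * c / V) * (u * c / V) = N * u / p := fun u => by
    field_simp
  rw [cancel, cancel] at hNw
  obtain ⟨X, hXN, hcov, hmult⟩ := exists_residues_of_ncard φ (fin (hAB.trans hBD)) (fin hBD)
    (hBi.mono fun x hx => hAB hx) hBi (hBi.mono fun x hx => hWB hx) N m₁ (by
      refine lt_of_mul_lt_mul_right ?_ (div_pos hc0 hV0).le
      calc _ = p * c / V * (Real.exp (-(N * {x : F | (x : EuclideanSpace ℝ (Fin n)) ∈ A₀}.ncard / p)) +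
            Real.exp ((Real.exp 1 - 1) * (N * {x : F | (x : EuclideanSpace ℝ (Fin n)) ∈ B₀}.ncard / p) - m₁)) := by ring
        _ < _ := hNw
        _ = _ := mul_div_assoc _ _ _)
  obtain ⟨T, hT, hTcov, hTmult⟩ := exists_arrangement_of_residues hK F φ hφ hη hη2
    (fun z => by
      obtain ⟨f, hf, hzf⟩ := hround z
      refine ⟨⟨f, hf⟩, hrW ?_, hrW ?_⟩
      · simpa using hzf
      · simpa [norm_sub_rev] using hzf)
    hinj X m₁ hcov hmult
  have hdisc := kernelLattice_discreteTopology F φ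
  have hlat := kernelLattice_isZLattice F φ
  refine ⟨kernelLattice F φ, hdisc, hlat, T, hTcov, hTmult, ?_⟩
  refine lt_of_le_of_lt ?_ hN
  rw [arrangementDensity, covolume_kernelLattice F φ hφ, div_div_eq_mul_div]
  change (T.card : ℝ) * V / (p * c) ≤ _
  have : (T.card : ℝ) ≤ N := by exact_mod_cast hT.trans hXN
  gcongr

/-! ### Reduction to `0` in the interior by translation. -/

theorem IsSpaceCovering.of_equiv {ι κ X : Type*} {F : ι → Set X} {G : κ → Set X}
    (h : IsSpaceCovering F) (e : ι ≃ κ) (he : ∀ i, G (e i) = F i) : IsSpaceCovering G := by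
  rw [IsSpaceCovering, ← e.surjective.iUnion_comp, ← h]
  simp only [he]

theorem MultiplicityAtMost.of_equiv {ι κ X : Type*} {F : ι → Set X} {G : κ → Set X} {m : ℝ}
    (h : MultiplicityAtMost F m) (e : ι ≃ κ) (he : ∀ i, G (e i) = F i) :
    MultiplicityAtMost G m := by
  intro x
  have : {k | x ∈ G k} = e '' {i | x ∈ F i} := by
    ext k
    obtain ⟨i, rfl⟩ := e.surjective k
    simp [he]
  rw [this, Set.ncard_image_of_injective _ e.injective]
  exact ⟨(h x).1.image e, (h x).2⟩

/-- Reindexing of the arrangement of a translate of `K` as an arrangement of `K`. -/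
def translateIndexEquiv {n : ℕ} (Λ : Submodule ℤ (EuclideanSpace ℝ (Fin n)))
    (T : Finset (EuclideanSpace ℝ (Fin n))) (c : EuclideanSpace ℝ (Fin n)) :
    Λ × T ≃ Λ × (T.map (Equiv.addRight c).toEmbedding) :=
  (Equiv.refl _).prodCongr ((Equiv.addRight c).subtypeEquiv fun t => by simp)

theorem periodicArrangement_translateIndexEquiv {n : ℕ} (K : Set (EuclideanSpace ℝ (Fin n)))
    (Λ : Submodule ℤ (EuclideanSpace ℝ (Fin n))) (T : Finset (EuclideanSpace ℝ (Fin n)))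
    (c : EuclideanSpace ℝ (Fin n)) (i : Λ × T) :
    periodicArrangement K Λ (T.map (Equiv.addRight c).toEmbedding) (translateIndexEquiv Λ T c i) =
      periodicArrangement (c +ᵥ K) Λ T i := by
  simp [periodicArrangement, translateIndexEquiv, vadd_vadd, add_assoc]

theorem mainTheorem4 :
    ∃ n₀ : ℕ, ∀ n : ℕ, n₀ ≤ n →
      ∀ K : ConvexBody (EuclideanSpace ℝ (Fin n)),
        (interior (K : Set (EuclideanSpace ℝ (Fin n)))).Nonempty →
        ∃ (Λ : Submodule ℤ (EuclideanSpace ℝ (Fin n)))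
          (_ : DiscreteTopology Λ) (_ : IsZLattice ℝ Λ)
          (T : Finset (EuclideanSpace ℝ (Fin n))),
          IsSpaceCovering
            (periodicArrangement (K : Set (EuclideanSpace ℝ (Fin n))) Λ T) ∧
          MultiplicityAtMost
            (periodicArrangement (K : Set (EuclideanSpace ℝ (Fin n))) Λ T)
            (Real.exp 1 * ((n : ℝ) * Real.log n + n * Real.log (Real.log n) + 4 * n)) ∧
          arrangementDensity (K : Set (EuclideanSpace ℝ (Fin n))) Λ T <
            (n : ℝ) * Real.log n + n * Real.log (Real.log n) + 4 * n := by
  obtain ⟨n₀, hn₀⟩ := Filter.eventually_atTop.1 eventually_log_bounds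
  refine ⟨n₀, fun n hn K hK => ?_⟩
  obtain ⟨hl, hL, hLl, hn'⟩ := hn₀ n hn
  obtain ⟨c, hc⟩ := hK
  obtain ⟨Λ, hΛ, hΛ', T, hcov, hmult, hdens⟩ := exists_arrangement_of_zero_mem_interior hl hL hLl
    hn' (K := -c +ᵥ (K : Set (EuclideanSpace ℝ (Fin n)))) (K.convex.vadd _) (K.isCompact.vadd _)
    (by
      rw [interior_vadd]
      exact ⟨c, hc, by simp⟩)
  refine ⟨Λ, hΛ, hΛ', T.map (Equiv.addRight (-c)).toEmbedding,
    hcov.of_equiv (translateIndexEquiv Λ T (-c)) (periodicArrangement_translateIndexEquiv _ Λ T _),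
    hmult.of_equiv (translateIndexEquiv Λ T (-c)) (periodicArrangement_translateIndexEquiv _ Λ T _),
    ?_⟩
  rw [arrangementDensity, measure_vadd] at hdens
  rwa [arrangementDensity, Finset.card_map]
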